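/- Let $\alpha\in\mathbb Z$, $n\in\mathbb Z_{\ge 0}$, $\epsilon=-n$, and let $\beta,\gamma,\delta,t,q\in\mathbb C$ satisfy $t\neq 0,1$ and $\gamma+\delta+\epsilon=\alpha+\beta+1$. Consider Heun's differential equation $$\frac{d^2y}{dz^2}+\left(\frac{\gamma}{z}+\frac{\delta}{z-1}+\frac{\epsilon}{z-t}\right)\frac{dy}{dz}+\frac{\alpha\beta z-q}{z(z-1)(z-t)}\,y=0,$$ and assume that the singularity $z=t$ (whose exponents are $0$ and $n+1$) is apparent, i.e. that there is a basis of local solutions at $z=t$ without logarithmic term: $f(z)=\sum_{j\ge0}c_j(z-t)^j$ and $g(z)=(z-t)^{n+1}\sum_{j\ge0}\tilde c_j(z-t)^j$ with convergent power series and $c_0\neq0$, $\tilde c_0\neq 0$. (i) If $\alpha>0$, then there is a non-zero polynomial $h$ of degree at most $\alpha+n-1$ such that $y(z)=z^{1-\gamma}(z-1)^{1-\delta}h(z)$ is a solution (that is, every holomorphic branch of this function on an open subset of $\mathbb C\setminus\{0,1,t\}$ is a solution there). (ii) If $\alpha<1-n$, then there is a non-zero polynomial solution $y(z)$ of degree at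 most $-\alpha$. (iii) If $1-n\le\alpha\le0$, then at least one of the following holds: there is a non-zero polynomial solution $y(z)$ of degree at most $-\alpha$, whose degree is exactly $-\alpha$ unless $\beta$ is an integer with $\alpha<\beta\le0$; or there is a non-zero polynomial $h$ of degree at most $\alpha+n-1$ such that $y(z)=z^{1-\gamma}(z-1)^{1-\delta}h(z)$ is a solution. -/

import Mathlib

open Filter Topology Polynomial

/-- Heun's differential equation
`y'' + (γ/z + δ/(z-1) + ε/(z-t)) y' + (αβz - q)/(z(z-1)(z-t)) y = 0` at the point `z`. -/
def HeunEqAt (α β γ δ ε t q : ℂ) (y : ℂ → ℂ) (z : ℂ) : Prop :=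
  deriv (deriv y) z + (γ / z + δ / (z - 1) + ε / (z - t)) * deriv y z
    + (α * β * z - q) / (z * (z - 1) * (z - t)) * y z = 0

/-- `y` is a (holomorphic) solution of Heun's equation on `U`; only used for open sets `U`
that do not contain `0`, `1`, `t`. -/
def IsHeunSolutionOn (α β γ δ ε t q : ℂ) (U : Set ℂ) (y : ℂ → ℂ) : Prop :=
  DifferentiableOn ℂ y U ∧ ∀ z ∈ U, HeunEqAt α β γ δ ε t q y z

/-- For `ε = -n`, `n` a natural number, the exponents at `z = t` are `0` and `n + 1`. The
singularity `z = t` is apparent if the local basis consisting of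
`f = ∑ cⱼ (z-t)^j + A g log (z-t)`, `c₀ ≠ 0`, and `g = (z-t)^(n+1) ∑ c̃ⱼ (z-t)^j`, `c̃₀ ≠ 0`,
has no logarithmic term (`A = 0`). Here `k` is the convergent power series in `g`. -/
def HeunApparent (α β γ δ : ℂ) (n : ℕ) (t q : ℂ) : Prop :=
  ∃ f k : ℂ → ℂ, AnalyticAt ℂ f t ∧ f t ≠ 0 ∧ AnalyticAt ℂ k t ∧ k t ≠ 0 ∧
    (∀ᶠ z in 𝓝[≠] t, HeunEqAt α β γ δ (-(n : ℂ)) t q f z) ∧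
    (∀ᶠ z in 𝓝[≠] t, HeunEqAt α β γ δ (-(n : ℂ)) t q (fun w => (w - t) ^ (n + 1) * k w) z)

/-- `L` is a holomorphic branch of `log (z - c)` on `U`. -/
def IsLogBranchOn (c : ℂ) (U : Set ℂ) (L : ℂ → ℂ) : Prop :=
  DifferentiableOn ℂ L U ∧ ∀ z ∈ U, Complex.exp (L z) = z - c

/-- The polynomial `p` is a solution of Heun's equation. -/
def IsHeunPolynomial (α β γ δ ε t q : ℂ) (p : ℂ[X]) : Prop :=
  IsHeunSolutionOn α β γ δ ε t q ({0, 1, t}ᶜ : Set ℂ) (fun z => p.eval z)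

/-- The multivalued function `z^σ₀ (z-1)^σ₁ h(z)` is a solution of Heun's equation: each of its
holomorphic branches, on each open set avoiding `0`, `1`, `t`, is a solution there. -/
def IsHeunPolynomialType (α β γ δ ε t q σ₀ σ₁ : ℂ) (h : ℂ[X]) : Prop :=
  ∀ U : Set ℂ, IsOpen U → U ⊆ ({0, 1, t}ᶜ : Set ℂ) →
    ∀ L₀ L₁ : ℂ → ℂ, IsLogBranchOn 0 U L₀ → IsLogBranchOn 1 U L₁ →
      IsHeunSolutionOn α β γ δ ε t q U
        (fun z => Complex.exp (σ₀ * L₀ z) * Complex.exp (σ₁ * L₁ z) * h.eval z)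

/-!
In the basis `(z - t) ^ j` Heun's operator is an infinite tridiagonal matrix whose principal minors
factor wherever an entry next to the diagonal vanishes: the entry from `j` to `j + 1` vanishes at
`j = -α, -β` and, for `ε = -n`, the entry from `j` to `j - 1` vanishes at `j = 0, n + 1`. The
leading minor of size `N` is zero exactly if some non-zero polynomial of degree less than `N` is
mapped to a multiple of `(z - t) ^ N`. When `t` is apparent, the Taylor polynomial of `f` of degree
`n` is such a polynomial for `N = n + 1`: because `n + 1` is an exponent, the image of the remainder
still vanishes to order `n + 1`. If the leading minor of size `m + 1` vanishes for `m = -α`, then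
the vanishing entry at `m` turns a kernel vector into a polynomial solution.

The gauge transformation `y = z ^ (1 - γ) (z - 1) ^ (1 - δ) h` leads to a Heun equation with `α`
replaced by `1 - n - α`, and on the indices `0, …, n` its matrix is the original one reflected in
the antidiagonal. For `1 - n ≤ α ≤ 0` the leading minor of size `n + 1` therefore splits as the
product of the leading minor of size `-α + 1` and the gauge transformed one of size `α + n`, one of
which has to vanish.
-/

section Minors

variable {R : Type*} [CommRing R]

/-- The principal minor of an infinite matrix with row and column indices `k, …, k + N - 1`. -/
def contiguousMinor (A : Matrix ℕ ℕ R) (k N : ℕ) : R :=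
  (A.submatrix (fun i : Fin N => k + (i : ℕ)) (fun j : Fin N => k + (j : ℕ))).det

lemma contiguousMinor_transpose (A : Matrix ℕ ℕ R) (k N : ℕ) :
    contiguousMinor A.transpose k N = contiguousMinor A k N := by
  rw [contiguousMinor, ← Matrix.transpose_submatrix, Matrix.det_transpose, contiguousMinor]

lemma contiguousMinor_add_of_lowerLeft_eq_zero {A : Matrix ℕ ℕ R} {k a : ℕ} (b : ℕ)
    (hA : ∀ i j, k + a ≤ i → j < k + a → A i j = 0) :
    contiguousMinor A k (a + b) = contiguousMinor A k a * contiguousMinor A (k + a) b := by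
  rw [contiguousMinor, ← Matrix.det_submatrix_equiv_self finSumFinEquiv]
  convert! Matrix.det_fromBlocks_zero₂₁ (A.submatrix (fun i : Fin a => k + (i : ℕ)) (k + ·))
    (A.submatrix (fun i : Fin a => k + (i : ℕ)) (fun j : Fin b => k + a + (j : ℕ)))
    (A.submatrix (fun i : Fin b => k + a + (i : ℕ)) (k + a + ·)) using 2
  ext (i | i) (j | j)
  · simp
  · simp [add_assoc]
  · simpa using hA _ _ (by omega) (by omega)
  · simp [add_assoc]

lemma contiguousMinor_add_of_upperRight_eq_zero {A : Matrix ℕ ℕ R} {k a : ℕ} (b : ℕ)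
    (hA : ∀ i j, i < k + a → k + a ≤ j → A i j = 0) :
    contiguousMinor A k (a + b) = contiguousMinor A k a * contiguousMinor A (k + a) b := by
  simpa only [contiguousMinor_transpose] using
    contiguousMinor_add_of_lowerLeft_eq_zero (A := A.transpose) b fun i j hi hj => hA j i hj hi

lemma contiguousMinor_eq_of_antitranspose {A B : Matrix ℕ ℕ R} {k l N s : ℕ}
    (hs : k + l + N = s + 1)
    (hAB : ∀ i j i' j', i + i' = s → j + j' = s → A i j = B j' i') :
    contiguousMinor A k N = contiguousMinor B l N := by
  rw [contiguousMinor, ← Matrix.det_transpose, contiguousMinor,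
    ← Matrix.det_submatrix_equiv_self Fin.revPerm (B.submatrix _ _)]
  congr 1
  ext i j
  simp only [Matrix.transpose_apply, Matrix.submatrix_apply, Fin.revPerm_apply, Fin.val_rev]
  exact hAB _ _ _ _ (by omega) (by omega)

/-- The infinite tridiagonal matrix whose column `j` has the entries `down j`, `diag j` and `up j`
in the rows `j - 1`, `j` and `j + 1`: as an operator on sequences, `up` raises the index and `down`
lowers it. The value `down 0` does not occur in the matrix. -/
def tridiagonal (up diag down : ℕ → R) : Matrix ℕ ℕ R :=
  Matrix.of fun i j =>
    if i = j then diag j else if i = j + 1 then up j else if j = i + 1 then down j else 0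

variable {up diag down up' diag' down' : ℕ → R}

lemma tridiagonal_of_lt {i j : ℕ} (hij : j + 1 < i) : tridiagonal up diag down i j = 0 := by
  simp only [tridiagonal, Matrix.of_apply]
  grind

lemma tridiagonal_succ (j : ℕ) : tridiagonal up diag down (j + 1) j = up j := by
  simp [tridiagonal]

lemma contiguousMinor_tridiagonal_add {k a : ℕ} (b : ℕ)
    (h : up (k + a) = 0 ∨ down (k + a + 1) = 0) :
    contiguousMinor (tridiagonal up diag down) k (a + 1 + b) =
      contiguousMinor (tridiagonal up diag down) k (a + 1) *
        contiguousMinor (tridiagonal up diag down) (k + (a + 1)) b := by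
  rcases h with h | h
  · refine contiguousMinor_add_of_lowerLeft_eq_zero b fun i j hi hj => ?_
    simp only [tridiagonal, Matrix.of_apply]
    grind
  · refine contiguousMinor_add_of_upperRight_eq_zero b fun i j hi hj => ?_
    simp only [tridiagonal, Matrix.of_apply]
    grind

lemma contiguousMinor_tridiagonal_eq_of_reflect {k l N s : ℕ} (hs : k + l + N = s + 1)
    (hup : ∀ i j, i + j + 1 = s → up i = up' j) (hdiag : ∀ i j, i + j = s → diag i = diag' j)
    (hdown : ∀ i j, i + j = s + 1 → down i = down' j) :
    contiguousMinor (tridiagonal up diag down) k N =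
      contiguousMinor (tridiagonal up' diag' down') l N := by
  refine contiguousMinor_eq_of_antitranspose hs fun i j i' j' hi hj => ?_
  simp only [tridiagonal, Matrix.of_apply]
  grind

end Minors

section HeunOperator

variable {R : Type*} [CommRing R] {α β γ δ ε t q : R}

/-- The polynomial form of Heun's operator, obtained by multiplying Heun's equation by
`z (z - 1) (z - t)`. -/
noncomputable def heunOp (α β γ δ ε t q : R) : R[X] →ₗ[R] R[X] :=
  LinearMap.mulLeft R (X * (X - 1) * (X - C t)) ∘ₗ derivative ∘ₗ derivative +
  LinearMap.mulLeft R (C γ * (X - 1) * (X - C t) + C δ * X * (X - C t) + C ε * X * (X - 1)) ∘ₗ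
    derivative +
  LinearMap.mulLeft R (C (α * β) * X - C q)

lemma heunOp_apply (P : R[X]) :
    heunOp α β γ δ ε t q P =
      X * (X - 1) * (X - C t) * derivative (derivative P) +
      (C γ * (X - 1) * (X - C t) + C δ * X * (X - C t) + C ε * X * (X - 1)) * derivative P +
      (C (α * β) * X - C q) * P := rfl

/-- Coefficient of `(z - t) ^ (j + 1)` in the image of `(z - t) ^ j` under Heun's operator. Its
zeros are the negatives of the exponents `α`, `β` at infinity. -/
def heunUp (α β : R) (j : ℕ) : R := (j + α) * (j + β)

/-- Coefficient of `(z - t) ^ j` in the image of `(z - t) ^ j` under Heun's operator. -/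
def heunDiag (α β γ δ ε t q : R) (j : ℕ) : R :=
  (2 * t - 1) * (j * (j - 1)) + j * (γ * (t - 1) + δ * t + ε * (2 * t - 1)) + α * β * t - q

/-- Coefficient of `(z - t) ^ (j - 1)` in the image of `(z - t) ^ j` under Heun's operator. Its
zeros are the exponents `0`, `1 - ε` at `t`. -/
def heunDown (ε t : R) (j : ℕ) : R := t * (t - 1) * (j * (j - 1 + ε))

/-- The matrix of Heun's operator in the basis `(z - t) ^ j`. -/
def heunMatrix (α β γ δ ε t q : R) : Matrix ℕ ℕ R :=
  tridiagonal (heunUp α β) (heunDiag α β γ δ ε t q) (heunDown ε t)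

lemma heunOp_X_sub_C_pow (hF : γ + δ + ε = α + β + 1) (j : ℕ) :
    heunOp α β γ δ ε t q ((X - C t) ^ j) = C (heunUp α β j) * (X - C t) ^ (j + 1) +
      C (heunDiag α β γ δ ε t q j) * (X - C t) ^ j + C (heunDown ε t j) * (X - C t) ^ (j - 1) := by
  obtain rfl : ε = α + β + 1 - γ - δ := by linear_combination hF
  rw [heunOp_apply, derivative_X_sub_C_pow, derivative_C_mul, derivative_X_sub_C_pow]
  rcases j with _ | _ | j
  all_goals
    simp only [heunUp, heunDiag, heunDown, zero_add, add_tsub_cancel_right, tsub_self, zero_tsub,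
      Nat.cast_add, Nat.cast_one, Nat.cast_zero, map_add, map_sub, map_mul, map_ofNat C 2, map_one,
      map_zero]
    ring

lemma coeff_taylor_heunOp_X_sub_C_pow (hF : γ + δ + ε = α + β + 1) (i j : ℕ) :
    (taylor t (heunOp α β γ δ ε t q ((X - C t) ^ j))).coeff i =
      heunMatrix α β γ δ ε t q i j := by
  have htaylor : ∀ k, taylor t ((X - C t) ^ k) = X ^ k := by simp [taylor_pow]
  simp only [heunOp_X_sub_C_pow hF, map_add, taylor_mul, taylor_C, htaylor, coeff_add, coeff_C_mul,
    coeff_X_pow, heunMatrix, tridiagonal, Matrix.of_apply]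
  rcases j with _ | j
  · simp only [heunDown]
    grind
  · grind

lemma coeff_taylor_heunOp (hF : γ + δ + ε = α + β + 1) {P : R[X]} {N : ℕ}
    (hP : P.natDegree < N) (i : ℕ) :
    (taylor t (heunOp α β γ δ ε t q P)).coeff i =
      ∑ j : Fin N, heunMatrix α β γ δ ε t q i j * (taylor t P).coeff j := by
  have hexpand : P = ∑ j : Fin N, (taylor t P).coeff j • (X - C t) ^ (j : ℕ) := by
    conv_lhs => rw [← sum_taylor_eq P t, sum_over_range' _ (by simp) N (by rwa [natDegree_taylor])]
    simp only [Finset.sum_range, smul_eq_C_mul]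
  conv_lhs => rw [hexpand]
  simp only [map_sum, map_smul, finsetSum_coeff, coeff_smul, smul_eq_mul,
    coeff_taylor_heunOp_X_sub_C_pow hF, mul_comm]

lemma coeff_succ_taylor_heunOp (hF : γ + δ + ε = α + β + 1) {P : R[X]} {i : ℕ}
    (hP : P.natDegree ≤ i) :
    (taylor t (heunOp α β γ δ ε t q P)).coeff (i + 1) = heunUp α β i * (taylor t P).coeff i := by
  rw [coeff_taylor_heunOp hF (Nat.lt_succ_of_le hP), Fin.sum_univ_castSucc, Finset.sum_eq_zero]
  · simp [heunMatrix, tridiagonal_succ]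
  · intro j _
    rw [heunMatrix, tridiagonal_of_lt (by simp), zero_mul]

lemma heunUp_natDegree_eq_zero [NoZeroDivisors R] (hF : γ + δ + ε = α + β + 1) {P : R[X]}
    (hP : P ≠ 0) (hker : heunOp α β γ δ ε t q P = 0) : heunUp α β P.natDegree = 0 := by
  have htop := coeff_succ_taylor_heunOp (t := t) (q := q) hF (le_refl P.natDegree)
  rw [hker, map_zero, coeff_zero, coeff_taylor_natDegree] at htop
  exact (mul_eq_zero.1 htop.symm).resolve_right (leadingCoeff_ne_zero.2 hP)

lemma contiguousMinor_heunMatrix_eq_zero_iff [IsDomain R] (hF : γ + δ + ε = α + β + 1) {N : ℕ} :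
    contiguousMinor (heunMatrix α β γ δ ε t q) 0 N = 0 ↔
      ∃ P : R[X], P ≠ 0 ∧ P.natDegree < N ∧ (X - C t) ^ N ∣ heunOp α β γ δ ε t q P := by
  have hdvd : ∀ Q : R[X], (X - C t) ^ N ∣ Q ↔ ∀ i < N, (taylor t Q).coeff i = 0 := fun Q => by
    rw [X_sub_C_pow_dvd_iff, X_pow_dvd_iff, taylor_apply]
  classical
  rw [contiguousMinor, ← Matrix.exists_mulVec_eq_zero_iff]
  constructor
  · rintro ⟨v, hv, hAv⟩
    obtain ⟨i₀, -⟩ := Function.ne_iff.1 hv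
    have htaylor : taylor t (taylor (-t) (ofFn N v)) = ofFn N v := by simp [taylor_taylor]
    have hdeg : (taylor (-t) (ofFn N v)).natDegree < N := by
      rw [natDegree_taylor]
      exact ofFn_natDegree_lt i₀.pos v
    refine ⟨taylor (-t) (ofFn N v), fun h => hv ?_, hdeg, (hdvd _).2 fun i hi => ?_⟩
    · rw [taylor_eq_zero] at h
      exact injective_ofFn N (h.trans (ofFn_zero N).symm)
    · rw [coeff_taylor_heunOp hF hdeg, htaylor]
      simpa [Matrix.mulVec, dotProduct] using congrFun hAv ⟨i, hi⟩
  · rintro ⟨P, hP, hdeg, hPdvd⟩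
    refine ⟨fun j => (taylor t P).coeff j, fun h => hP ?_, funext fun i => ?_⟩
    · rw [← taylor_eq_zero t, ← leadingCoeff_eq_zero, leadingCoeff, natDegree_taylor]
      exact congrFun h ⟨_, hdeg⟩
    · have hi := (hdvd _).1 hPdvd i i.2
      rw [coeff_taylor_heunOp hF hdeg] at hi
      simpa [Matrix.mulVec, dotProduct] using hi

lemma exists_heunOp_eq_zero [IsDomain R] (hF : γ + δ + ε = α + β + 1) {m : ℕ}
    (hm : heunUp α β m = 0)
    (hminor : contiguousMinor (heunMatrix α β γ δ ε t q) 0 (m + 1) = 0) :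
    ∃ P : R[X], P ≠ 0 ∧ P.natDegree ≤ m ∧ heunOp α β γ δ ε t q P = 0 := by
  obtain ⟨P, hP, hdeg, hdvd⟩ := (contiguousMinor_heunMatrix_eq_zero_iff hF).1 hminor
  rw [Nat.lt_succ_iff] at hdeg
  rw [X_sub_C_pow_dvd_iff, X_pow_dvd_iff] at hdvd
  refine ⟨P, hP, hdeg, (taylor_eq_zero t _).1 (ext fun i => ?_)⟩
  rcases lt_or_ge i (m + 1) with hi | hi
  · exact hdvd i hi
  obtain ⟨i, rfl⟩ : ∃ j, i = j + 1 := ⟨i - 1, by omega⟩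
  rw [coeff_succ_taylor_heunOp hF (by omega), coeff_zero]
  obtain rfl | hi := eq_or_lt_of_le (Nat.le_of_succ_le_succ hi)
  · rw [hm, zero_mul]
  · rw [coeff_eq_zero_of_natDegree_lt (by rw [natDegree_taylor]; omega), mul_zero]

end HeunOperator
section Analytic

variable {𝕜 : Type*} [NontriviallyNormedField 𝕜] {t : 𝕜}

lemma analyticAt_polynomial_eval (P : 𝕜[X]) (t : 𝕜) : AnalyticAt 𝕜 (fun z => P.eval z) t :=
  AnalyticOnNhd.eval_polynomial P t (Set.mem_univ t)

lemma analyticOrderAt_polynomial_eval {P : 𝕜[X]} (hP : P ≠ 0) (t : 𝕜) :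
    analyticOrderAt (fun z => P.eval z) t = P.rootMultiplicity t := by
  obtain ⟨Q, hPQ, hQ⟩ := exists_eq_pow_rootMultiplicity_mul_and_not_dvd P hP t
  refine (analyticAt_polynomial_eval P t).analyticOrderAt_eq_natCast.2
    ⟨fun z => Q.eval z, analyticAt_polynomial_eval Q t, ?_, .of_forall fun z => ?_⟩
  · rwa [dvd_iff_isRoot] at hQ
  · conv_lhs => rw [hPQ]
    simp

lemma X_sub_C_pow_dvd_of_le_analyticOrderAt {P : 𝕜[X]} {N : ℕ}
    (h : N ≤ analyticOrderAt (fun z => P.eval z) t) : (X - C t) ^ N ∣ P := by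
  rcases eq_or_ne P 0 with rfl | hP
  · exact dvd_zero _
  · rw [analyticOrderAt_polynomial_eval hP, Nat.cast_le] at h
    exact (le_rootMultiplicity_iff hP).1 h

lemma exists_polynomial_le_analyticOrderAt_sub [CharZero 𝕜] [CompleteSpace 𝕜] {f : 𝕜 → 𝕜}
    (hf : AnalyticAt 𝕜 f t) (n : ℕ) :
    ∃ P : 𝕜[X], P.natDegree ≤ n ∧
      (n + 1 : ℕ) ≤ analyticOrderAt (fun z => f z - P.eval z) t := by
  have hshift : AnalyticAt 𝕜 (fun w => f (t + w)) 0 :=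
    AnalyticAt.fun_comp (by simpa using hf) (by fun_prop)
  obtain ⟨r, hr, hfr⟩ := hshift.exists_eq_sum_add_pow_mul (n + 1)
  set c : ℕ → 𝕜 := fun i => iteratedDeriv i (fun w => f (t + w)) 0 / i.factorial
  refine ⟨∑ i ∈ Finset.range (n + 1), C (c i) * (X - C t) ^ i, ?_, ?_⟩
  · refine natDegree_sum_le_of_forall_le _ _ fun i hi => (natDegree_C_mul_le _ _).trans ?_
    simpa [natDegree_pow, Nat.lt_succ_iff] using hi
  · rw [natCast_le_analyticOrderAt (hf.fun_sub (analyticAt_polynomial_eval _ t))]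
    refine ⟨fun z => r (z - t), AnalyticAt.fun_comp (by simpa using hr) (by fun_prop),
      .of_forall fun z => ?_⟩
    have hz := hfr (z - t)
    rw [add_sub_cancel] at hz
    simp only [hz, eval_finsetSum, eval_mul, eval_C, eval_pow, eval_sub, eval_X, smul_eq_mul, c,
      div_mul_eq_mul_div, mul_comm (iteratedDeriv _ _ _), add_sub_cancel_left]

lemma le_analyticOrderAt_euler [CompleteSpace 𝕜] {f : 𝕜 → 𝕜} {n : ℕ} (hf : AnalyticAt 𝕜 f t)
    (h : n ≤ analyticOrderAt f t) :
    (n + 1 : ℕ) ≤ analyticOrderAt (fun z => (z - t) * deriv f z - n * f z) t := by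
  obtain ⟨g, hg, hfg⟩ := (natCast_le_analyticOrderAt hf).1 h
  rw [natCast_le_analyticOrderAt (by fun_prop)]
  refine ⟨deriv g, hg.deriv, ?_⟩
  filter_upwards [hfg.eventually_nhds, hg.eventually_analyticAt] with z hz hgz
  have hpow : HasDerivAt (fun w => (w - t) ^ n) (n * (z - t) ^ (n - 1)) z := by
    simpa using ((hasDerivAt_id' z).sub_const t).fun_pow n
  have hderiv : deriv f z = n * (z - t) ^ (n - 1) * g z + (z - t) ^ n * deriv g z :=
    (EventuallyEq.deriv_eq hz).trans (hpow.fun_mul hgz.differentiableAt.hasDerivAt).deriv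
  rw [hderiv, hz.self_of_nhds]
  rcases n with _ | n
  · simp
  · simp only [Nat.add_sub_cancel, smul_eq_mul]
    ring

end Analytic

section HeunFunction

variable {α β γ δ ε t q : ℂ}

/-- The left-hand side of Heun's equation multiplied by `z (z - 1) (z - t)`, which has no poles and
extends `heunOp` from polynomials to functions. -/
noncomputable def heunFun (α β γ δ ε t q : ℂ) (y : ℂ → ℂ) (z : ℂ) : ℂ :=
  z * (z - 1) * (z - t) * deriv (deriv y) z +
    (γ * (z - 1) * (z - t) + δ * z * (z - t) + ε * z * (z - 1)) * deriv y z +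
    (α * β * z - q) * y z

lemma heunEqAt_iff_heunFun_eq_zero {y : ℂ → ℂ} {z : ℂ} (hz0 : z ≠ 0) (hz1 : z ≠ 1) (hzt : z ≠ t) :
    HeunEqAt α β γ δ ε t q y z ↔ heunFun α β γ δ ε t q y z = 0 := by
  have hz1' : z - 1 ≠ 0 := sub_ne_zero.2 hz1
  have hzt' : z - t ≠ 0 := sub_ne_zero.2 hzt
  rw [HeunEqAt, heunFun, ← mul_right_inj' (mul_ne_zero (mul_ne_zero hz0 hz1') hzt'), mul_zero]
  refine Eq.congr_left ?_
  field_simp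

lemma deriv_polynomial_eval (P : ℂ[X]) :
    deriv (fun z => P.eval z) = fun z => (derivative P).eval z :=
  funext fun _ => P.deriv

lemma heunFun_polynomial_eval (P : ℂ[X]) (z : ℂ) :
    heunFun α β γ δ ε t q (fun w => P.eval w) z = (heunOp α β γ δ ε t q P).eval z := by
  simp [heunFun, heunOp_apply, deriv_polynomial_eval]

lemma heunFun_sub {y₁ y₂ : ℂ → ℂ} {z : ℂ} (h₁ : AnalyticAt ℂ y₁ z) (h₂ : AnalyticAt ℂ y₂ z) :
    heunFun α β γ δ ε t q (fun w => y₁ w - y₂ w) z =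
      heunFun α β γ δ ε t q y₁ z - heunFun α β γ δ ε t q y₂ z := by
  have hderiv : deriv (fun w => y₁ w - y₂ w) =ᶠ[𝓝 z] fun w => deriv y₁ w - deriv y₂ w := by
    filter_upwards [h₁.eventually_analyticAt, h₂.eventually_analyticAt] with w hw₁ hw₂
    exact deriv_fun_sub hw₁.differentiableAt hw₂.differentiableAt
  simp only [heunFun]
  rw [hderiv.deriv_eq, hderiv.eq_of_nhds,
    deriv_fun_sub h₁.deriv.differentiableAt h₂.deriv.differentiableAt]
  ring

lemma analyticAt_heunFun {y : ℂ → ℂ} {z : ℂ} (hy : AnalyticAt ℂ y z) :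
    AnalyticAt ℂ (heunFun α β γ δ ε t q y) z := by
  unfold heunFun
  fun_prop

/-- With `ε = -n` the terms of lowest order form `z (z - 1)` times the Euler operator
`(z - t) d/dz - n` applied to `y'`, which raises the order `n` of `y'`. -/
lemma le_analyticOrderAt_heunFun {n : ℕ} {y : ℂ → ℂ} (hy : AnalyticAt ℂ y t)
    (h : (n + 1 : ℕ) ≤ analyticOrderAt y t) :
    (n + 1 : ℕ) ≤ analyticOrderAt (heunFun α β γ δ (-(n : ℂ)) t q y) t := by
  have hyt : y t = 0 := apply_eq_zero_of_analyticOrderAt_ne_zero fun h0 => by simp [h0] at h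
  have hy' : n ≤ analyticOrderAt (deriv y) t :=
    (analyticOrderAt_deriv_ge_iff hy hyt).2 (mod_cast h)
  obtain ⟨e, he, heq⟩ := (natCast_le_analyticOrderAt (by fun_prop)).1
    (le_analyticOrderAt_euler hy.deriv hy')
  obtain ⟨g, hg, hgeq⟩ := (natCast_le_analyticOrderAt hy.deriv).1 hy'
  obtain ⟨k, hk, hkeq⟩ := (natCast_le_analyticOrderAt hy).1 h
  refine (natCast_le_analyticOrderAt (analyticAt_heunFun hy)).2
    ⟨fun z => z * (z - 1) * e z + (γ * (z - 1) + δ * z) * g z + (α * β * z - q) * k z,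
      by fun_prop, ?_⟩
  filter_upwards [heq, hgeq, hkeq] with z hez hgz hkz
  simp only [smul_eq_mul] at hez hgz hkz ⊢
  rw [heunFun]
  linear_combination z * (z - 1) * hez + (γ * (z - 1) + δ * z) * (z - t) * hgz +
    (α * β * z - q) * hkz

lemma IsHeunPolynomial.of_heunOp_eq_zero {P : ℂ[X]} (hP : heunOp α β γ δ ε t q P = 0) :
    IsHeunPolynomial α β γ δ ε t q P := by
  refine ⟨P.differentiable.differentiableOn, fun z hz => ?_⟩
  simp only [Set.mem_compl_iff, Set.mem_insert_iff, Set.mem_singleton_iff, not_or] at hz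
  rw [heunEqAt_iff_heunFun_eq_zero hz.1 hz.2.1 hz.2.2, heunFun_polynomial_eval, hP, eval_zero]

end HeunFunction

section Apparent

variable {α β γ δ t q : ℂ} {n : ℕ}

lemma heunFun_eventuallyEq_zero {ε : ℂ} {f : ℂ → ℂ} (ht0 : t ≠ 0) (ht1 : t ≠ 1)
    (hf : AnalyticAt ℂ f t) (h : ∀ᶠ z in 𝓝[≠] t, HeunEqAt α β γ δ ε t q f z) :
    heunFun α β γ δ ε t q f =ᶠ[𝓝 t] 0 := by
  refine (ContinuousAt.eventuallyEq_nhds_iff_eventuallyEq_nhdsNE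
    (analyticAt_heunFun hf).continuousAt continuousAt_const).1 ?_
  filter_upwards [h, self_mem_nhdsWithin, eventually_ne_nhdsWithin ht0,
    eventually_ne_nhdsWithin ht1] with z hz hzt hz0 hz1
  exact (heunEqAt_iff_heunFun_eq_zero hz0 hz1 hzt).1 hz

lemma HeunApparent.contiguousMinor_heunMatrix_eq_zero (happ : HeunApparent α β γ δ n t q)
    (ht0 : t ≠ 0) (ht1 : t ≠ 1) (hF : γ + δ + (-(n : ℂ)) = α + β + 1) :
    contiguousMinor (heunMatrix α β γ δ (-(n : ℂ)) t q) 0 (n + 1) = 0 := by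
  obtain ⟨f, -, hf, hft, -, -, hsol, -⟩ := happ
  obtain ⟨P, hdeg, hord⟩ := exists_polynomial_le_analyticOrderAt_sub hf n
  have han := hf.fun_sub (analyticAt_polynomial_eval P t)
  refine (contiguousMinor_heunMatrix_eq_zero_iff hF).2
    ⟨P, ?_, Nat.lt_succ_of_le hdeg, X_sub_C_pow_dvd_of_le_analyticOrderAt ?_⟩
  · rintro rfl
    exact hft (apply_eq_zero_of_analyticOrderAt_ne_zero fun h0 => by simp [h0] at hord)
  · have hremainder : heunFun α β γ δ (-(n : ℂ)) t q (fun z => f z - P.eval z) =ᶠ[𝓝 t]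
        -fun z => (heunOp α β γ δ (-(n : ℂ)) t q P).eval z := by
      filter_upwards [heunFun_eventuallyEq_zero ht0 ht1 hf hsol, hf.eventually_analyticAt]
        with z hfz hz
      rw [heunFun_sub hz (analyticAt_polynomial_eval P z), hfz, heunFun_polynomial_eval]
      simp
    rw [← analyticOrderAt_neg, ← analyticOrderAt_congr hremainder]
    exact le_analyticOrderAt_heunFun han hord

lemma contiguousMinor_heunMatrix_eq_zero_of_le {m : ℕ} (hnm : n ≤ m)
    (h : contiguousMinor (heunMatrix α β γ δ (-(n : ℂ)) t q) 0 (n + 1) = 0) :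
    contiguousMinor (heunMatrix α β γ δ (-(n : ℂ)) t q) 0 (m + 1) = 0 := by
  obtain ⟨b, rfl⟩ := Nat.exists_eq_add_of_le hnm
  rw [heunMatrix] at h ⊢
  rw [add_right_comm, contiguousMinor_tridiagonal_add b (Or.inr (by simp [heunDown])), h, zero_mul]

end Apparent

section Gauge

variable {α β γ δ ε t q : ℂ}

/-- The accessory parameter `q` of the Heun equation satisfied by `h` when
`z ^ (1 - γ) (z - 1) ^ (1 - δ) h` satisfies the one with parameters `γ`, `δ`, `ε`, `t`, `q`. The
other parameters become `1 + ε - α`, `1 + ε - β`, `2 - γ`, `2 - δ`, `ε`, `t`. -/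
def gaugeAccessory (γ δ ε t q : ℂ) : ℂ := q + (2 - γ - δ) * t + ε * (1 - γ)

lemma deriv_fun_mul_of_hasDerivAt_logDeriv {𝕜 : Type*} [NontriviallyNormedField 𝕜]
    {W u : 𝕜 → 𝕜} {s z : 𝕜} (hW : HasDerivAt W (s * W z) z) (hu : DifferentiableAt 𝕜 u z) :
    deriv (fun w => W w * u w) z = W z * (deriv u z + s * u z) := by
  rw [(hW.fun_mul hu.hasDerivAt).deriv]
  ring

lemma deriv_deriv_fun_mul_of_hasDerivAt_logDeriv {𝕜 : Type*} [NontriviallyNormedField 𝕜]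
    {W s u : 𝕜 → 𝕜} {z s' : 𝕜} (hW : ∀ᶠ w in 𝓝 z, HasDerivAt W (s w * W w) w)
    (hs : HasDerivAt s s' z) (hu : ∀ᶠ w in 𝓝 z, DifferentiableAt 𝕜 u w)
    (hu' : DifferentiableAt 𝕜 (deriv u) z) :
    deriv (deriv fun w => W w * u w) z =
      W z * (deriv (deriv u) z + 2 * s z * deriv u z + (s' + s z ^ 2) * u z) := by
  have hderiv : deriv (fun w => W w * u w) =ᶠ[𝓝 z] fun w => W w * (deriv u w + s w * u w) := by
    filter_upwards [hW, hu] with w hWw huw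
    exact deriv_fun_mul_of_hasDerivAt_logDeriv hWw huw
  have hsu := hs.fun_mul hu.self_of_nhds.hasDerivAt
  rw [hderiv.deriv_eq, deriv_fun_mul_of_hasDerivAt_logDeriv hW.self_of_nhds
    (hu'.fun_add hsu.differentiableAt), deriv_fun_add hu' hsu.differentiableAt, hsu.deriv]
  ring

lemma HeunEqAt.of_gauge {W u : ℂ → ℂ} {z : ℂ} (hF : γ + δ + ε = α + β + 1)
    (hz : z ∈ ({0, 1, t}ᶜ : Set ℂ))
    (hW : ∀ᶠ w in 𝓝 z, HasDerivAt W (((1 - γ) / w + (1 - δ) / (w - 1)) * W w) w)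
    (hu : AnalyticAt ℂ u z)
    (h : HeunEqAt (1 + ε - α) (1 + ε - β) (2 - γ) (2 - δ) ε t (gaugeAccessory γ δ ε t q) u z) :
    HeunEqAt α β γ δ ε t q (fun w => W w * u w) z := by
  simp only [Set.mem_compl_iff, Set.mem_insert_iff, Set.mem_singleton_iff, not_or] at hz
  obtain ⟨hz0, hz1, hzt⟩ := hz
  have hz1' : z - 1 ≠ 0 := sub_ne_zero.2 hz1
  have hzt' : z - t ≠ 0 := sub_ne_zero.2 hzt
  have hs : HasDerivAt (fun w => (1 - γ) / w + (1 - δ) / (w - 1))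
      (-(1 - γ) / z ^ 2 + -(1 - δ) / (z - 1) ^ 2) z := by
    simpa using ((hasDerivAt_const z (1 - γ)).fun_div (hasDerivAt_id' z) hz0).fun_add
      ((hasDerivAt_const z (1 - δ)).fun_div ((hasDerivAt_id' z).sub_const 1) hz1')
  have hdiff := hu.eventually_analyticAt.mono fun _ hw => hw.differentiableAt
  rw [HeunEqAt, deriv_deriv_fun_mul_of_hasDerivAt_logDeriv hW hs hdiff hu.deriv.differentiableAt,
    deriv_fun_mul_of_hasDerivAt_logDeriv hW.self_of_nhds hu.differentiableAt]
  obtain rfl : ε = α + β + 1 - γ - δ := by linear_combination hF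
  rw [← mul_zero (W z), ← h, gaugeAccessory]
  field_simp
  ring

lemma IsLogBranchOn.hasDerivAt {c : ℂ} {U : Set ℂ} {L : ℂ → ℂ} (hL : IsLogBranchOn c U L)
    (hU : IsOpen U) {z : ℂ} (hz : z ∈ U) : HasDerivAt L (1 / (z - c)) z := by
  have hLz : HasDerivAt L (deriv L z) z := (hL.1.differentiableAt (hU.mem_nhds hz)).hasDerivAt
  have hexp : HasDerivAt (fun w => Complex.exp (L w)) 1 z :=
    ((hasDerivAt_id z).sub_const c).congr_of_eventuallyEq
      (Filter.eventually_of_mem (hU.mem_nhds hz) hL.2)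
  have hmul : (z - c) * deriv L z = 1 := hL.2 z hz ▸ hLz.cexp.unique hexp
  rwa [eq_div_of_mul_eq (left_ne_zero_of_mul_eq_one hmul) ((mul_comm _ _).trans hmul)] at hLz

lemma IsHeunPolynomial.isHeunPolynomialType {h : ℂ[X]} (hF : γ + δ + ε = α + β + 1)
    (hh : IsHeunPolynomial (1 + ε - α) (1 + ε - β) (2 - γ) (2 - δ) ε t
      (gaugeAccessory γ δ ε t q) h) :
    IsHeunPolynomialType α β γ δ ε t q (1 - γ) (1 - δ) h := by
  intro U hU hsub L₀ L₁ h₀ h₁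
  have hW : ∀ z ∈ U, HasDerivAt
      (fun w => Complex.exp ((1 - γ) * L₀ w) * Complex.exp ((1 - δ) * L₁ w))
      (((1 - γ) / z + (1 - δ) / (z - 1)) *
        (Complex.exp ((1 - γ) * L₀ z) * Complex.exp ((1 - δ) * L₁ z))) z := fun z hz => by
    refine (((h₀.hasDerivAt hU hz).const_mul (1 - γ)).cexp.fun_mul
      ((h₁.hasDerivAt hU hz).const_mul (1 - δ)).cexp).congr_deriv ?_
    rw [sub_zero]
    ring
  refine ⟨fun z hz => ?_, fun z hz => ?_⟩
  · exact ((hW z hz).differentiableAt.mul h.differentiableAt).differentiableWithinAt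
  · exact .of_gauge hF (hsub hz) (Filter.eventually_of_mem (hU.mem_nhds hz) hW)
      (analyticAt_polynomial_eval h z) (hh.2 z (hsub hz))

lemma contiguousMinor_heunMatrix_gauge {n k l N : ℕ} (hF : γ + δ + (-(n : ℂ)) = α + β + 1)
    (hN : k + l + N = n + 1) :
    contiguousMinor (heunMatrix (1 + -(n : ℂ) - α) (1 + -(n : ℂ) - β) (2 - γ) (2 - δ) (-(n : ℂ)) t
        (gaugeAccessory γ δ (-(n : ℂ)) t q)) k N =
      contiguousMinor (heunMatrix α β γ δ (-(n : ℂ)) t q) l N := by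
  obtain rfl : δ = α + β + 1 + n - γ := by linear_combination hF
  refine contiguousMinor_tridiagonal_eq_of_reflect hN (fun i j hij => ?_) (fun i j hij => ?_)
    fun i j hij => ?_
  · subst hij
    simp only [heunUp]
    push_cast
    ring
  · subst hij
    simp only [heunDiag, gaugeAccessory]
    push_cast
    ring
  · have hcast : (i : ℂ) + j = n + 1 := mod_cast hij
    simp only [heunDown]
    linear_combination t * (t - 1) * (i - j) * hcast

end Gauge

section Existence

variable {α β γ δ ε t q : ℂ} {m : ℕ}

lemma heunUp_eq_zero_of_eq_neg (hα : α = -m) : heunUp α β m = 0 := by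
  rw [heunUp, hα, add_neg_cancel, zero_mul]

lemma exists_isHeunPolynomial (hF : γ + δ + ε = α + β + 1) (hα : α = -m)
    (hminor : contiguousMinor (heunMatrix α β γ δ ε t q) 0 (m + 1) = 0) :
    ∃ p : ℂ[X], p ≠ 0 ∧ p.natDegree ≤ m ∧ heunUp α β p.natDegree = 0 ∧
      IsHeunPolynomial α β γ δ ε t q p := by
  obtain ⟨p, hp, hdeg, hker⟩ := exists_heunOp_eq_zero hF (heunUp_eq_zero_of_eq_neg hα) hminor
  exact ⟨p, hp, hdeg, heunUp_natDegree_eq_zero hF hp hker, .of_heunOp_eq_zero hker⟩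

lemma exists_isHeunPolynomialType (hF : γ + δ + ε = α + β + 1) (hα : 1 + ε - α = -m)
    (hminor : contiguousMinor (heunMatrix (1 + ε - α) (1 + ε - β) (2 - γ) (2 - δ) ε t
      (gaugeAccessory γ δ ε t q)) 0 (m + 1) = 0) :
    ∃ h : ℂ[X], h ≠ 0 ∧ h.natDegree ≤ m ∧
      IsHeunPolynomialType α β γ δ ε t q (1 - γ) (1 - δ) h := by
  obtain ⟨h, hh, hdeg, -, hsol⟩ :=
    exists_isHeunPolynomial (by linear_combination -hF) hα hminor
  exact ⟨h, hh, hdeg, hsol.isHeunPolynomialType hF⟩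

lemma eq_neg_of_heunUp_eq_zero {a : ℤ} {d : ℕ} (hd : heunUp (a : ℂ) β d = 0)
    (hda : (d : ℤ) ≤ -a) (hβ : ¬ ∃ b : ℤ, β = b ∧ a < b ∧ b ≤ 0) : (d : ℤ) = -a := by
  rcases mul_eq_zero.1 hd with hd | hd
  · exact eq_neg_of_add_eq_zero_left (mod_cast hd)
  · by_contra hne
    refine hβ ⟨-d, ?_, by omega, by omega⟩
    push_cast
    exact eq_neg_of_add_eq_zero_right hd

variable {n k : ℕ}

lemma contiguousMinor_heunMatrix_eq_zero_or_gauge (hF : γ + δ + (-(n : ℂ)) = α + β + 1)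
    (hα : α = -m) (hn : n = m + 1 + k)
    (hminor : contiguousMinor (heunMatrix α β γ δ (-(n : ℂ)) t q) 0 (n + 1) = 0) :
    contiguousMinor (heunMatrix α β γ δ (-(n : ℂ)) t q) 0 (m + 1) = 0 ∨
      contiguousMinor (heunMatrix (1 + -(n : ℂ) - α) (1 + -(n : ℂ) - β) (2 - γ) (2 - δ) (-(n : ℂ))
        t (gaugeAccessory γ δ (-(n : ℂ)) t q)) 0 (k + 1) = 0 := by
  have hup : heunUp α β (0 + m) = 0 := by rw [zero_add, heunUp_eq_zero_of_eq_neg hα]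
  have hsize : n + 1 = m + 1 + (k + 1) := by omega
  rw [contiguousMinor_heunMatrix_gauge hF (l := m + 1) (by omega), ← mul_eq_zero, ← hminor, hsize,
    heunMatrix, contiguousMinor_tridiagonal_add _ (.inl hup), zero_add]

end Existence

theorem mainTheorem5 (a : ℤ) (n : ℕ) (β γ δ t q : ℂ) (ht0 : t ≠ 0) (ht1 : t ≠ 1)
    (hfuchs : γ + δ + (-(n : ℂ)) = (a : ℂ) + β + 1)
    (happ : HeunApparent (a : ℂ) β γ δ n t q) :
    (0 < a →
      ∃ h : ℂ[X], h ≠ 0 ∧ (h.natDegree : ℤ) ≤ a + n - 1 ∧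
        IsHeunPolynomialType (a : ℂ) β γ δ (-(n : ℂ)) t q (1 - γ) (1 - δ) h) ∧
    (a < 1 - n →
      ∃ p : ℂ[X], p ≠ 0 ∧ (p.natDegree : ℤ) ≤ -a ∧
        IsHeunPolynomial (a : ℂ) β γ δ (-(n : ℂ)) t q p) ∧
    (1 - n ≤ a → a ≤ 0 →
      (∃ p : ℂ[X], p ≠ 0 ∧ (p.natDegree : ℤ) ≤ -a ∧
        ((¬ ∃ m : ℤ, β = (m : ℂ) ∧ a < m ∧ m ≤ 0) → (p.natDegree : ℤ) = -a) ∧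
        IsHeunPolynomial (a : ℂ) β γ δ (-(n : ℂ)) t q p) ∨
      (∃ h : ℂ[X], h ≠ 0 ∧ (h.natDegree : ℤ) ≤ a + n - 1 ∧
        IsHeunPolynomialType (a : ℂ) β γ δ (-(n : ℂ)) t q (1 - γ) (1 - δ) h)) := by
  have hminor := happ.contiguousMinor_heunMatrix_eq_zero ht0 ht1 hfuchs
  have hpoly (m : ℕ) (hm : a = -m) := exists_isHeunPolynomial (m := m) (t := t) (q := q) hfuchs
    (by exact_mod_cast congrArg (Int.cast : ℤ → ℂ) hm)
  have htype (m : ℕ) (hm : a = m + 1 - n) := exists_isHeunPolynomialType (m := m) (t := t) (q := q)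
    hfuchs (by rw [hm]; push_cast; ring)
  refine ⟨fun ha => ?_, fun ha => ?_, fun ha ha0 => ?_⟩
  · obtain ⟨m, rfl⟩ : ∃ m : ℕ, a = m + 1 - n := ⟨(a + n - 1).toNat, by omega⟩
    obtain ⟨h, hh, hdeg, hsol⟩ := htype m rfl <| contiguousMinor_heunMatrix_eq_zero_of_le (by omega)
      ((contiguousMinor_heunMatrix_gauge hfuchs (by omega)).trans hminor)
    exact ⟨h, hh, by omega, hsol⟩
  · obtain ⟨m, rfl⟩ : ∃ m : ℕ, a = -m := ⟨(-a).toNat, by omega⟩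
    obtain ⟨p, hp, hdeg, -, hsol⟩ := hpoly m rfl <|
      contiguousMinor_heunMatrix_eq_zero_of_le (by omega) hminor
    exact ⟨p, hp, by omega, hsol⟩
  · obtain ⟨m, hm⟩ : ∃ m : ℕ, a = -m := ⟨(-a).toNat, by omega⟩
    obtain ⟨k, hn⟩ : ∃ k : ℕ, n = m + 1 + k := ⟨n - m - 1, by omega⟩
    rcases contiguousMinor_heunMatrix_eq_zero_or_gauge hfuchs (by rw [hm]; push_cast; rfl) hn hminor
      with hblock | hblock
    · obtain ⟨p, hp, hdeg, hup, hsol⟩ := hpoly m hm hblock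
      exact .inl ⟨p, hp, by omega, eq_neg_of_heunUp_eq_zero hup (by omega), hsol⟩
    · obtain ⟨h, hh, hdeg, hsol⟩ := htype k (by omega) hblock
      exact .inr ⟨h, hh, by omega, hsol⟩
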